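/- \textbf{Setting.} On a probability space let $X$ be a random vector in $\mathbb{R}^d$ (covariates), $A\in\{0,1\}$ a treatment with $u:=P(A=1)\in(0,1)$, and $Y_0,Y_1$ real potential outcomes with values in an interval $\mathcal{Y}\subseteq\mathbb{R}$. For $t\in\{0,1\}$ let $p(Y_t=y\mid x)$ be a (jointly measurable) conditional density of $Y_t$ given $X=x$ on $\mathcal{Y}$, which is $\kappa$-Lipschitz in $x\in\mathbb{R}^d$ for every $y\in\mathcal{Y}$, where $\kappa>0$. Let $L:\mathcal{Y}\times\mathcal{Y}\to[0,\infty)$ be a loss that is $K_L$-Lipschitz in each argument ($K_L>0$) and satisfies $\int_{\mathcal{Y}}L(y_1,y_2)\,dy_1\le M$ for all $y_2\in\mathcal{Y}$. Let $\Phi:\mathbb{R}^d\to\mathbb{R}^d$ be one-to-one, $C^1$ and Jacobian-normalized, i.e. $\sup_x\sigma_{\max}(\partial\Phi(x)/\partial x)=1$, with $\inf_x\sigma_{\min}(\partial\Phi(x)/\partial x)>0$, and put $\rho(\Phi)=\sup_x\sigma_{\max}(\partial\Phi(x)/\partial x)\,/\,\inf_x\sigma_{\min}(\partial\Phi(x)/\partial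 x)$. Let $h:\mathbb{R}^d\times\{0,1\}\to\mathcal{Y}$ be such that $h(\cdot,t)$ is $b\kappa$-Lipschitz for $t=0,1$, where $b\ge0$. Put $$\ell_{h,\Phi}(x,t)=\int_{\mathcal{Y}}L\bigl(y,h(\Phi(x),t)\bigr)\,p(Y_t=y\mid x)\,dy,\qquad \epsilon_{CF}=\int_{\mathbb{R}^d\times\{0,1\}}\ell_{h,\Phi}(x,t)\,p(x,1-t)\,dx\,dt,$$ $$\epsilon_F^{t=a}=\mathbb{E}\bigl[\ell_{h,\Phi}(X,a)\mid A=a\bigr],\qquad \epsilon_F^\star=(1-u)\,\epsilon_F^{t=1}+u\,\epsilon_F^{t=0},$$ where $p(x,t)$ denotes the joint law of $(X,A)$ and $p(x,1-t)$ that of $(X,1-A)$. Let $W_1(\mu,\nu)=\sup\{\mathbb{E}_\mu f-\mathbb{E}_\nu f: f\ 1\text{-Lipschitz}\}$ be the Wasserstein-1 distance, let $p_\Phi^a$ be the law of $\Phi(X)$ given $A=a$, and suppose that $p_\Phi^a=\sum_{k=1}^K w_k^aP_{\Phi,k}^a$ with probability weights $(w_k^a)_{k}$ for $a\in\{0,1\}$.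 \textbf{Theorem (SGA improves generalization bounds).} Assume: \textbf{A1.} For all $a$ and $k$, $P_{\Phi,k}^a$ is a (possibly degenerate) Gaussian distribution with mean $m_k^a$ and covariance $\Sigma_k^a$; and $W_1(P_{\Phi,k}^0,P_{\Phi,k}^1)\le W_1(P_{\Phi,k}^0,P_{\Phi,k'}^1)$ whenever $k\ne k'$. \textbf{A2.} $w_k^1=w_k^0$ for all $k$, and there is $\varepsilon>0$ with $\operatorname{tr}\Sigma_k^a\le\varepsilon$ for all $a$ and $k$. Then all integrals in $\ell_{h,\Phi}$, and those of $\ell_{h,\Phi}$ against $p(x,t)$ and $p(x,1-t)$, converge, and $$\text{(i)}\quad \epsilon_{CF}\le\epsilon_F^\star+2B_\Phi\sum_{k=1}^K w_k^1\,W_1(P_{\Phi,k}^0,P_{\Phi,k}^1),\qquad B_\Phi=\bigl(M\rho(\Phi)+b\,K_L\bigr)\,\kappa ;$$ if $K_L\ge1$, (i) also holds with $B_\Phi=(M\rho(\Phi)+b)\,\kappa\,K_L$; $$\text{(ii)}\quad \sum_{k=1}^K w_k^1\,W_1(P_{\Phi,k}^0,P_{\Phi,k}^1)\le W_1(p_\Phi^0,p_\Phi^1)+4\sqrt{\varepsilon}.$$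 -/

import Mathlib

open MeasureTheory ProbabilityTheory

noncomputable section

/-- Kantorovich–Rubinstein form of the Wasserstein-1 distance: the supremum of
`𝔼_μ f - 𝔼_ν f` over all 1-Lipschitz `f`. For probability measures with finite first moment
all these expectations exist and the supremum is finite. -/
def W1 {E : Type*} [PseudoMetricSpace E] [MeasurableSpace E] (μ ν : Measure E) : ℝ :=
  ⨆ f : {f : E → ℝ // LipschitzWith 1 f}, ((∫ x, f.1 x ∂μ) - ∫ x, f.1 x ∂ν)

/-- The largest singular value of the Jacobian of `Φ` at `x`. -/
def sigmaMax {d : ℕ} (Φ : EuclideanSpace ℝ (Fin d) → EuclideanSpace ℝ (Fin d))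
    (x : EuclideanSpace ℝ (Fin d)) : ℝ :=
  (fderiv ℝ Φ x).toLinearMap.singularValues 0

/-- The smallest (that is, the `d`-th) singular value of the Jacobian of `Φ` at `x`. -/
def sigmaMin {d : ℕ} (Φ : EuclideanSpace ℝ (Fin d) → EuclideanSpace ℝ (Fin d))
    (x : EuclideanSpace ℝ (Fin d)) : ℝ :=
  (fderiv ℝ Φ x).toLinearMap.singularValues (d - 1)

/-- `Φ` is Jacobian-normalized: `sup_x σ_max(∂Φ(x)/∂x) = 1`. -/
def JacobianNormalized {d : ℕ}
    (Φ : EuclideanSpace ℝ (Fin d) → EuclideanSpace ℝ (Fin d)) : Prop :=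
  IsLUB (Set.range (sigmaMax Φ)) 1

/-- `ρ(Φ)`: the supremum of `σ_max` divided by the infimum of `σ_min`
(meant for `Φ` with bounded `σ_max` and with `inf_x σ_min > 0`). -/
def rho {d : ℕ} (Φ : EuclideanSpace ℝ (Fin d) → EuclideanSpace ℝ (Fin d)) : ℝ :=
  (⨆ x, sigmaMax Φ x) / (⨅ x, sigmaMin Φ x)

/-- `q x y` is (a version of) the density `p(Y = y | x)` of the `S`-valued random variable `Y`
given `X = x`, with respect to Lebesgue measure on `S ⊆ ℝ`. -/
structure IsCondDensity {Ω E : Type*} [MeasurableSpace Ω] [MeasurableSpace E]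
    (P : Measure Ω) (X : Ω → E) (Y : Ω → ℝ) (S : Set ℝ) (q : E → ℝ → ℝ) : Prop where
  measurable : Measurable (Function.uncurry q)
  nonneg : ∀ x, ∀ y ∈ S, 0 ≤ q x y
  integral_eq_one : ∀ x, ∫ y in S, q x y = 1
  map_eq : P.map (fun ω => (X ω, Y ω)) =
    ((P.map X).prod (volume.restrict S)).withDensity (fun z => ENNReal.ofReal (q z.1 z.2))

/-- The expected loss `ℓ_{h,Φ}(x, t) = ∫ L(y, h(Φ(x), t)) p(Y_t = y | x) dy`
for the unit and treatment pair `(x, t)`. -/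
def unitLoss {E R : Type*} (S : Set ℝ) (L : ℝ → ℝ → ℝ) (q : Fin 2 → E → ℝ → ℝ)
    (h : R → Fin 2 → ℝ) (Φ : E → R) (x : E) (t : Fin 2) : ℝ :=
  ∫ y in S, L y (h (Φ x) t) * q t x y

section Losses

variable {Ω E : Type*} [MeasurableSpace Ω] [MeasurableSpace E]

/-- The distribution `p(x, t)` of covariates and treatment. -/
def factualLaw (P : Measure Ω) (X : Ω → E) (A : Ω → Fin 2) : Measure (E × Fin 2) :=
  P.map (fun ω => (X ω, A ω))

/-- The distribution `p(x, 1 - t)`, as a measure in `(x, t)`. -/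
def counterfactualLaw (P : Measure Ω) (X : Ω → E) (A : Ω → Fin 2) : Measure (E × Fin 2) :=
  P.map (fun ω => (X ω, 1 - A ω))

/-- The distribution of the covariates given treatment `a`. -/
def covariateLaw (P : Measure Ω) (X : Ω → E) (A : Ω → Fin 2) (a : Fin 2) : Measure E :=
  (ProbabilityTheory.cond P (A ⁻¹' {a})).map X

/-- `p_Φ^a`: the distribution of the representation `Φ(X)` given treatment `a`. -/
def repLaw {R : Type*} [MeasurableSpace R] (P : Measure Ω) (X : Ω → E) (A : Ω → Fin 2)
    (Φ : E → R) (a : Fin 2) : Measure R :=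
  (ProbabilityTheory.cond P (A ⁻¹' {a})).map (fun ω => Φ (X ω))

/-- The expected counterfactual loss `ε_CF = ∫ ℓ(x, t) p(x, 1 - t)`,
for a unit loss `l`. -/
def counterfactualLoss (P : Measure Ω) (X : Ω → E) (A : Ω → Fin 2) (l : E → Fin 2 → ℝ) : ℝ :=
  ∫ z, l z.1 z.2 ∂(counterfactualLaw P X A)

/-- The factual loss in arm `t`, `ε_F^{t} = ∫ ℓ(x, t) p(x | t) dx`. -/
def armFactualLoss (P : Measure Ω) (X : Ω → E) (A : Ω → Fin 2) (l : E → Fin 2 → ℝ)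
    (t : Fin 2) : ℝ :=
  ∫ x, l x t ∂(covariateLaw P X A t)

/-- `ε_F^⋆ = (1 - u) ε_F^{t=1} + u ε_F^{t=0}`, with `u = p(t = 1)`. -/
def factualLossStar (P : Measure Ω) (X : Ω → E) (A : Ω → Fin 2) (l : E → Fin 2 → ℝ) : ℝ :=
  (1 - P.real (A ⁻¹' {1})) * armFactualLoss P X A l 1 +
    P.real (A ⁻¹' {1}) * armFactualLoss P X A l 0

end Losses

end

/-! For (i), the unit loss is a Lipschitz function of the representation. Since the singular values
of the Jacobian are bounded below, `Φ` expands distances up to the factor `rho Φ`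
(`norm_sub_le_of_iInf_sigmaMin_pos`). Hence the density and the hypothesis are both Lipschitz in `Φ
x`, and so is `unitLoss` (`abs_unitLoss_sub_le`). The counterfactual loss and `ε_F^⋆` carry the same
weights with the arms exchanged, so they differ by a convex combination of gaps between the two
representation laws. Duality, applied component by component to the equally weighted mixtures,
bounds each gap by `B_Φ` times the weighted sum of distances; the factor 2 is slack.

For (ii), test `W1` with the distance to the set of means of arm 1. It nearly vanishes on arm 1. On
component `k` of arm 0 it is nearly the distance from that mean to the nearest mean of arm 1, and by
A1 this is at least the distance between the partners, up to the spread (`sum_mul_W1_le_W1_add`). -/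

/-! ### Lower Lipschitz bounds from singular values of the Jacobian. -/

/-- The smallest singular value bounds a linear map from below. -/
theorem LinearMap.singularValues_pred_finrank_mul_norm_le {E F : Type*}
    [NormedAddCommGroup E] [InnerProductSpace ℝ E] [FiniteDimensional ℝ E]
    [NormedAddCommGroup F] [InnerProductSpace ℝ F] [FiniteDimensional ℝ F]
    (T : E →ₗ[ℝ] F) {n : ℕ} (hn : Module.finrank ℝ E = n) (v : E) :
    T.singularValues (n - 1) * ‖v‖ ≤ ‖T v‖ := by
  have hT := T.isSymmetric_adjoint_comp_self
  let B := hT.eigenvectorBasis hn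
  have h1 : ‖T v‖ ^ 2 = ∑ i, hT.eigenvalues hn i * (B.repr v i) ^ 2 := by
    have : ‖T v‖ ^ 2 = inner ℝ v ((LinearMap.adjoint T ∘ₗ T) v) := by
      rw [LinearMap.comp_apply, LinearMap.adjoint_inner_right, real_inner_self_eq_norm_sq]
    rw [this, ← B.sum_inner_mul_inner]
    refine Finset.sum_congr rfl fun i _ ↦ ?_
    rw [← B.repr_apply_apply ((LinearMap.adjoint T ∘ₗ T) v) i,
      hT.eigenvectorBasis_apply_self_apply hn, real_inner_comm, ← B.repr_apply_apply]
    simp only [RCLike.ofReal_real_eq_id, id_eq]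
    ring
  have h2 : ‖v‖ ^ 2 = ∑ i, (B.repr v i) ^ 2 := by
    rw [← B.sum_sq_norm_inner_right v]
    simp [B.repr_apply_apply]
  refine le_of_sq_le_sq ?_ (norm_nonneg _)
  rw [mul_pow, h1, h2, Finset.mul_sum]
  refine Finset.sum_le_sum fun i _ ↦ mul_le_mul_of_nonneg_right ?_ (sq_nonneg _)
  rw [← T.sq_singularValues_fin hn i]
  exact pow_le_pow_left₀ (T.singularValues_nonneg _)
    (T.singularValues_antitone (by have := i.isLt; omega)) 2

section Inverse

variable {E F : Type*} [NormedAddCommGroup E] [NormedSpace ℝ E] [FiniteDimensional ℝ E]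
  [NormedAddCommGroup F] [NormedSpace ℝ F] {Φ : E → F} {Φ' : E → E ≃L[ℝ] F}

/-- The inverse function theorem gives a local inverse; injectivity forces the global `invFun` to
agree with it near `Φ x`. -/
theorem hasFDerivAt_invFun_of_injective (hΦ : ∀ x, HasStrictFDerivAt Φ (Φ' x : E →L[ℝ] F) x)
    (hinj : Function.Injective Φ) (x : E) :
    HasFDerivAt (Function.invFun Φ) ((Φ' x).symm : F →L[ℝ] E) (Φ x) ∧
      Set.range Φ ∈ nhds (Φ x) := by
  have := FiniteDimensional.complete ℝ E
  have hr := (hΦ x).eventually_right_inverse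
  refine ⟨(hΦ x).to_localInverse.hasFDerivAt.congr_of_eventuallyEq ?_, ?_⟩
  · filter_upwards [hr] with y hy
    rw [← Function.leftInverse_invFun hinj ((hΦ x).localInverse Φ (Φ' x) x y), hy]
  · filter_upwards [hr] with y hy using ⟨_, hy⟩

/-- An injective local diffeomorphism whose derivative has inverses bounded by `C` is antilipschitz
with constant `C`. -/
theorem norm_sub_le_mul_norm_sub_of_injective
    (hΦ : ∀ x, HasStrictFDerivAt Φ (Φ' x : E →L[ℝ] F) x)
    (hinj : Function.Injective Φ) {C : ℝ} (hC0 : 0 ≤ C) (hC : ∀ x v, ‖v‖ ≤ C * ‖Φ' x v‖)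
    (x x' : E) : ‖x - x'‖ ≤ C * ‖Φ x - Φ x'‖ := by
  set G := Function.invFun Φ
  have hG : ∀ x, G (Φ x) = x := Function.leftInverse_invFun hinj
  set v := Φ x - Φ x'
  let γ : ℝ → F := fun s ↦ Φ x' + s • v
  have hγc : Continuous γ := by fun_prop
  have hγd : ∀ s, HasDerivAt γ v s := fun s ↦ by
    simpa [γ] using ((hasDerivAt_id s).smul_const v).const_add (Φ x')
  have hder : ∀ s, γ s ∈ Set.range Φ → ∃ w, HasDerivAt (G ∘ γ) w s ∧ ‖w‖ ≤ C * ‖v‖ := by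
    rintro s ⟨z, hz⟩
    refine ⟨(Φ' z).symm v, ?_, by simpa using hC z ((Φ' z).symm v)⟩
    have h := (hasFDerivAt_invFun_of_injective hΦ hinj z).1
    rw [hz] at h
    exact h.comp_hasDerivAt s (hγd s)
  have hopen : IsOpen (Set.range Φ) := by
    refine isOpen_iff_mem_nhds.2 ?_
    rintro _ ⟨z, rfl⟩
    exact (hasFDerivAt_invFun_of_injective hΦ hinj z).2
  -- The range need not be convex a priori. At a first exit time `s`, the lift of the segment is
  -- Lipschitz on `[0, s)`, so it extends to `s`, and continuity puts `γ s` back in the range.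
  have hall : ∀ s ∈ Set.Icc (0 : ℝ) 1, γ s ∈ Set.range Φ := by
    by_contra! hne
    obtain ⟨s₀, hs₀, hs₀'⟩ := hne
    have hcomp : IsCompact (Set.Icc (0 : ℝ) 1 ∩ γ ⁻¹' (Set.range Φ)ᶜ) :=
      isCompact_Icc.inter_right (hopen.isClosed_compl.preimage hγc)
    obtain ⟨s, ⟨hs, hsn⟩, hmin⟩ := hcomp.exists_isLeast ⟨s₀, hs₀, hs₀'⟩
    have hlt : ∀ r ∈ Set.Ico (0 : ℝ) s, γ r ∈ Set.range Φ := fun r hr ↦ by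
      by_contra hn
      exact absurd (hmin ⟨⟨hr.1, hr.2.le.trans hs.2⟩, hn⟩) (not_le.2 hr.2)
    have hpos : 0 < s := by
      refine lt_of_le_of_ne hs.1 ?_
      rintro rfl
      exact hsn ⟨x', by simp [γ]⟩
    have hlip : LipschitzOnWith ⟨C * ‖v‖, by positivity⟩ (G ∘ γ) (Set.Ico 0 s) := by
      refine (convex_Ico 0 s).lipschitzOnWith_of_nnnorm_hasDerivWithin_le
        (f' := deriv (G ∘ γ)) ?_ ?_
      · intro r hr
        obtain ⟨w, hw, _⟩ := hder r (hlt r hr)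
        exact hw.differentiableAt.hasDerivAt.hasDerivWithinAt
      · intro r hr
        obtain ⟨w, hw, hwb⟩ := hder r (hlt r hr)
        rw [hw.deriv]
        exact hwb
    obtain ⟨g, hg, hgeq⟩ := hlip.extend_finite_dimension
    have hΦc : Continuous Φ := continuous_iff_continuousAt.2 fun z ↦ (hΦ z).continuousAt
    have heq : Set.EqOn (fun r ↦ Φ (g r)) γ (Set.Ico 0 s) := fun r hr ↦ by
      obtain ⟨z, hz⟩ := hlt r hr
      simp only [← hgeq hr, Function.comp_apply, ← hz, hG]
    refine hsn ⟨g s, heq.closure (hΦc.comp hg.continuous) hγc ?_⟩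
    rw [closure_Ico hpos.ne]
    exact ⟨hpos.le, le_rfl⟩
  have := norm_image_sub_le_of_norm_deriv_le_segment_01' (f := G ∘ γ) (f' := deriv (G ∘ γ))
    (C := C * ‖v‖) ?_ ?_
  · simpa [γ, v, hG] using this
  · intro r hr
    obtain ⟨w, hw, _⟩ := hder r (hall r hr)
    exact hw.differentiableAt.hasDerivAt.hasDerivWithinAt
  · intro r hr
    obtain ⟨w, hw, hwb⟩ := hder r (hall r ⟨hr.1, hr.2.le⟩)
    rw [hw.deriv]
    exact hwb

end Inverse

theorem norm_sub_le_of_iInf_sigmaMin_pos {d : ℕ}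
    {Φ : EuclideanSpace ℝ (Fin d) → EuclideanSpace ℝ (Fin d)}
    (hΦ : ContDiff ℝ 1 Φ) (hinj : Function.Injective Φ) (hpos : 0 < ⨅ x, sigmaMin Φ x)
    (x x' : EuclideanSpace ℝ (Fin d)) :
    ‖x - x'‖ ≤ (⨅ x, sigmaMin Φ x)⁻¹ * ‖Φ x - Φ x'‖ := by
  set c := ⨅ x, sigmaMin Φ x
  have hle : ∀ x v, c * ‖v‖ ≤ ‖fderiv ℝ Φ x v‖ := fun x v ↦ by
    have hc : c ≤ sigmaMin Φ x := ciInf_le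
      ⟨0, Set.forall_mem_range.2 fun x ↦ LinearMap.singularValues_nonneg _ _⟩ x
    exact (mul_le_mul_of_nonneg_right hc (norm_nonneg v)).trans
      (LinearMap.singularValues_pred_finrank_mul_norm_le (fderiv ℝ Φ x).toLinearMap (by simp) v)
  have hker : ∀ x, Function.Injective (fderiv ℝ Φ x).toLinearMap := fun x ↦ by
    refine (injective_iff_map_eq_zero _).2 fun v hv ↦ ?_
    have := hle x v
    rw [show fderiv ℝ Φ x v = 0 from hv, norm_zero] at this
    exact norm_le_zero_iff.1 (nonpos_of_mul_nonpos_right this hpos)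
  let Φ' := fun x ↦ (LinearEquiv.ofInjectiveEndo _ (hker x)).toContinuousLinearEquiv
  have hΦ' : ∀ x, (Φ' x : EuclideanSpace ℝ (Fin d) →L[ℝ] EuclideanSpace ℝ (Fin d)) =
      fderiv ℝ Φ x := fun x ↦ by ext1 v; rfl
  refine norm_sub_le_mul_norm_sub_of_injective (Φ' := Φ') (fun x ↦ ?_) hinj
    (inv_nonneg.2 hpos.le) (fun x v ↦ ?_) x x'
  · rw [hΦ']
    exact hΦ.contDiffAt.hasStrictFDerivAt one_ne_zero
  · rw [inv_mul_eq_div, le_div_iff₀ hpos, mul_comm]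
    exact hle x v

theorem rho_eq_inv {d : ℕ} {Φ : EuclideanSpace ℝ (Fin d) → EuclideanSpace ℝ (Fin d)}
    (hΦ : JacobianNormalized Φ) : rho Φ = (⨅ x, sigmaMin Φ x)⁻¹ := by
  rw [rho, iSup, hΦ.csSup_eq (Set.range_nonempty _), one_div]

/-! ### Wasserstein-1 estimates. -/

section W1

variable {E : Type*} [NormedAddCommGroup E] [MeasurableSpace E] [BorelSpace E]
  {μ ν : Measure E}

theorem LipschitzWith.integrable_of_integrable_id [IsFiniteMeasure μ] {K : NNReal} {f : E → ℝ}
    (hf : LipschitzWith K f) (hμ : Integrable (fun x ↦ x) μ) : Integrable f μ := by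
  refine ((integrable_const ‖f 0‖).add (hμ.norm.const_mul K)).mono'
    hf.continuous.aestronglyMeasurable (ae_of_all _ fun x ↦ ?_)
  have h1 := hf.norm_sub_le x 0
  have h2 := norm_le_norm_add_norm_sub (f 0) (f x)
  rw [sub_zero] at h1
  rw [norm_sub_rev] at h1
  simp only [Pi.add_apply]
  linarith

variable [IsProbabilityMeasure μ] [IsProbabilityMeasure ν]

theorem abs_integral_sub_le_of_lipschitzWith {f : E → ℝ} (hf : LipschitzWith 1 f)
    (hμ : Integrable (fun x ↦ x) μ) (a : E) :
    |∫ x, f x ∂μ - f a| ≤ ∫ x, ‖x - a‖ ∂μ := by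
  have h : ∫ x, f x ∂μ - f a = ∫ x, (f x - f a) ∂μ := by
    rw [integral_sub (hf.integrable_of_integrable_id hμ) (integrable_const _)]
    simp
  rw [h, ← Real.norm_eq_abs]
  refine norm_integral_le_of_norm_le (hμ.sub (integrable_const a)).norm (ae_of_all _ fun x ↦ ?_)
  simpa using hf.norm_sub_le x a

/-- Triangle inequality through point masses at `a` and `a'`. Being uniform in `f`, the bound also
makes the real supremum in `W1` a genuine one. -/
theorem integral_sub_integral_le_add_of_lipschitzWith {f : E → ℝ} (hf : LipschitzWith 1 f)
    (hμ : Integrable (fun x ↦ x) μ) (hν : Integrable (fun x ↦ x) ν) (a a' : E) :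
    ∫ x, f x ∂μ - ∫ x, f x ∂ν ≤ ‖a - a'‖ + ∫ x, ‖x - a‖ ∂μ + ∫ x, ‖x - a'‖ ∂ν := by
  have h1 := (abs_le.1 (abs_integral_sub_le_of_lipschitzWith hf hμ a)).2
  have h2 := (abs_le.1 (abs_integral_sub_le_of_lipschitzWith hf hν a')).1
  have h3 := hf.norm_sub_le a a'
  have h4 := Real.le_norm_self (f a - f a')
  rw [NNReal.coe_one, one_mul] at h3
  linarith

theorem W1_le_add (hμ : Integrable (fun x ↦ x) μ) (hν : Integrable (fun x ↦ x) ν) (a a' : E) :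
    W1 μ ν ≤ ‖a - a'‖ + ∫ x, ‖x - a‖ ∂μ + ∫ x, ‖x - a'‖ ∂ν :=
  haveI : Nonempty {f : E → ℝ // LipschitzWith 1 f} := ⟨⟨_, LipschitzWith.const' 0⟩⟩
  ciSup_le fun f ↦ integral_sub_integral_le_add_of_lipschitzWith f.2 hμ hν a a'

theorem integral_sub_integral_le_W1 (hμ : Integrable (fun x ↦ x) μ)
    (hν : Integrable (fun x ↦ x) ν) {f : E → ℝ} (hf : LipschitzWith 1 f) :
    ∫ x, f x ∂μ - ∫ x, f x ∂ν ≤ W1 μ ν :=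
  le_ciSup (f := fun f : {f : E → ℝ // LipschitzWith 1 f} ↦ (∫ x, f.1 x ∂μ) - ∫ x, f.1 x ∂ν)
    ⟨_, Set.forall_mem_range.2 fun f ↦
      integral_sub_integral_le_add_of_lipschitzWith f.2 hμ hν 0 0⟩ ⟨f, hf⟩

theorem W1_nonneg (hμ : Integrable (fun x ↦ x) μ) (hν : Integrable (fun x ↦ x) ν) :
    0 ≤ W1 μ ν := by
  simpa using integral_sub_integral_le_W1 hμ hν (LipschitzWith.const' (0 : ℝ))

theorem abs_integral_sub_integral_le_mul_W1 (hμ : Integrable (fun x ↦ x) μ)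
    (hν : Integrable (fun x ↦ x) ν) {K : NNReal} {f : E → ℝ} (hf : LipschitzWith K f) :
    |∫ x, f x ∂μ - ∫ x, f x ∂ν| ≤ K * W1 μ ν := by
  -- The main argument rescales `f` by `K⁻¹`, so the constant case is separate.
  rcases eq_or_ne K 0 with rfl | hK
  · obtain ⟨c, rfl⟩ : ∃ c, f = fun _ ↦ c :=
      ⟨f 0, funext fun x ↦ by simpa [sub_eq_zero] using hf.norm_sub_le x 0⟩
    simp
  have hK' : (0 : ℝ) < K := lt_of_le_of_ne K.2 (by exact_mod_cast hK.symm)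
  have key : ∀ s : ℝ, |s| = 1 → s * (∫ x, f x ∂μ - ∫ x, f x ∂ν) ≤ K * W1 μ ν := fun s hs ↦ by
    have hg : LipschitzWith 1 fun x ↦ (s * (K : ℝ)⁻¹) * f x := by
      refine LipschitzWith.of_dist_le_mul fun x y ↦ ?_
      rw [Real.dist_eq, ← mul_sub, abs_mul, abs_mul, hs, one_mul, abs_of_pos (inv_pos.2 hK'),
        NNReal.coe_one, one_mul, inv_mul_le_iff₀ hK', ← Real.dist_eq]
      exact hf.dist_le_mul x y
    have h := integral_sub_integral_le_W1 hμ hν hg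
    rw [integral_const_mul, integral_const_mul, ← mul_sub] at h
    have h' := mul_le_mul_of_nonneg_left h hK'.le
    calc _ = (K : ℝ) * (s * (K : ℝ)⁻¹ * (∫ x, f x ∂μ - ∫ x, f x ∂ν)) := by field_simp
      _ ≤ _ := h'
  refine abs_le.2 ⟨?_, ?_⟩
  · have := key (-1) (by simp)
    linarith
  · have := key 1 (by simp)
    linarith

end W1

/-! ### Spread of a Gaussian about its mean. -/

section Gaussian

variable {ι : Type*} [Fintype ι] [DecidableEq ι] (m : EuclideanSpace ℝ ι) {C : Matrix ι ι ℝ}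

theorem integral_norm_sub_mean_le_sqrt_trace (hC : C.PosSemidef) :
    ∫ x, ‖x - m‖ ∂(multivariateGaussian m C) ≤ √C.trace := by
  set μ := multivariateGaussian m C
  have hLp : MemLp (fun x ↦ x - m) 2 μ := (IsGaussian.memLp_two_id (μ := μ)).sub (memLp_const m)
  have hid : Integrable (fun x ↦ x) μ := IsGaussian.integrable_id
  have hmean : ∀ i, ∫ x, x i ∂μ = m i := fun i ↦ by
    have := (EuclideanSpace.proj i : EuclideanSpace ℝ ι →L[ℝ] ℝ).integral_comp_comm hid
    simpa [μ] using this
  have hcoord : ∀ i, MemLp (fun x : EuclideanSpace ℝ ι ↦ x i) 2 μ := fun i ↦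
    (EuclideanSpace.proj i : EuclideanSpace ℝ ι →L[ℝ] ℝ).comp_memLp' IsGaussian.memLp_two_id
  have hcoord' : ∀ i, MemLp (fun x : EuclideanSpace ℝ ι ↦ x i - m i) 2 μ := fun i ↦
    (hcoord i).sub (memLp_const (m i))
  have hvar : ∀ i, ∫ x, (x i - m i) ^ 2 ∂μ = C i i := fun i ↦ by
    have h := variance_eval_multivariateGaussian (μ := m) hC i
    rw [variance_eq_integral (by fun_prop)] at h
    simpa [μ, hmean i] using h
  have hsq : ∫ x, ‖x - m‖ ^ 2 ∂μ = C.trace := by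
    simp only [EuclideanSpace.norm_sq_eq, PiLp.sub_apply, Real.norm_eq_abs, sq_abs]
    rw [integral_finsetSum _ fun i _ ↦ (hcoord' i).integrable_sq]
    simp [hvar, Matrix.trace]
  refine Real.le_sqrt_of_sq_le ?_
  -- The first moment is controlled by the second: nonnegative variance is `(𝔼‖x - m‖)² ≤ 𝔼‖x -
  -- m‖²`.
  have h := variance_nonneg (fun x ↦ ‖x - m‖) μ
  rw [variance_eq_sub hLp.norm] at h
  simp only [Pi.pow_apply] at h
  linarith

end Gaussian

/-! ### Integrability and regularity of the unit loss. -/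

section LipschitzIntegrable

/-- A Lipschitz function that is nonnegative and integrable on an interval is bounded there. -/
theorem exists_le_of_lipschitz_of_integrableOn {S : Set ℝ} (hS : S.OrdConnected) {g : ℝ → ℝ}
    {K : ℝ} (hK : 0 ≤ K) (hg0 : ∀ y ∈ S, 0 ≤ g y)
    (hg : ∀ y ∈ S, ∀ y' ∈ S, |g y - g y'| ≤ K * |y - y'|) (hgi : IntegrableOn g S) :
    ∃ c, ∀ y ∈ S, g y ≤ c := by
  -- On a unit interval `g` stays above `g y - K`, so its integral there is at least `g y - K`. An
  -- unbounded `S` has such an interval at each of its points; a bounded `S` is handled by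
  -- comparison with one point.
  have key : ∀ a, Set.Icc a (a + 1) ⊆ S → ∀ y ∈ Set.Icc a (a + 1), g y ≤ (∫ z in S, g z) + K := by
    intro a ha y hy
    have h1 : ∫ z in Set.Icc a (a + 1), (g y - K) ≤ ∫ z in Set.Icc a (a + 1), g z := by
      refine setIntegral_mono_on (integrable_const _) (hgi.mono_set ha) measurableSet_Icc
        fun z hz ↦ ?_
      have h2 := (abs_le.1 (hg y (ha hy) z (ha hz))).2
      have h3 : |y - z| ≤ 1 := abs_le.2 ⟨by linarith [hy.1, hz.2], by linarith [hy.2, hz.1]⟩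
      nlinarith
    have h4 : ∫ z in Set.Icc a (a + 1), g z ≤ ∫ z in S, g z :=
      setIntegral_mono_set hgi ((ae_restrict_iff' hS.measurableSet).2 (ae_of_all _ hg0))
        (ae_of_all _ ha)
    simp only [integral_const, measureReal_restrict_apply_univ, Real.volume_real_Icc,
      add_sub_cancel_left, zero_le_one, sup_of_le_left, one_smul] at h1
    linarith
  by_cases hA : BddAbove S
  · by_cases hB : BddBelow S
    · obtain ⟨u, hu⟩ := hA
      obtain ⟨l, hl⟩ := hB
      rcases S.eq_empty_or_nonempty with rfl | ⟨y₀, hy₀⟩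
      · exact ⟨0, by simp⟩
      refine ⟨g y₀ + K * (u - l), fun y hy ↦ ?_⟩
      have h2 := (abs_le.1 (hg y hy y₀ hy₀)).2
      have h3 : |y - y₀| ≤ u - l :=
        abs_le.2 ⟨by linarith [hl hy, hu hy₀], by linarith [hu hy, hl hy₀]⟩
      nlinarith
    · refine ⟨_, fun y hy ↦ key (y - 1) ?_ y ⟨by linarith, by linarith⟩⟩
      obtain ⟨z, hz, hzy⟩ := not_bddBelow_iff.1 hB (y - 1)
      exact (Set.Icc_subset_Icc hzy.le (by linarith)).trans (hS.out hz hy)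
  · refine ⟨_, fun y hy ↦ key y ?_ y ⟨le_rfl, by linarith⟩⟩
    obtain ⟨z, hz, hzy⟩ := not_bddAbove_iff.1 hA (y + 1)
    exact (Set.Icc_subset_Icc le_rfl hzy.le).trans (hS.out hy hz)

end LipschitzIntegrable

theorem IsCondDensity.integrableOn {Ω E : Type*} [MeasurableSpace Ω] [MeasurableSpace E]
    {P : Measure Ω} {X : Ω → E} {Y : Ω → ℝ} {S : Set ℝ} {q : E → ℝ → ℝ}
    (hq : IsCondDensity P X Y S q) (x : E) : IntegrableOn (q x) S :=
  -- A non-integrable function would have integral 0, not 1.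
  not_imp_comm.1 integral_undef (by simp [hq.integral_eq_one x])

section UnitLoss

variable {E R : Type*} [NormedAddCommGroup R]
  {S : Set ℝ} {q : Fin 2 → E → ℝ → ℝ} {κ : ℝ} {L : ℝ → ℝ → ℝ} {KL M : ℝ}
  {Φ : E → R} {h : R → Fin 2 → ℝ} {b : ℝ}

theorem integrableOn_loss_mul_density (hS : S.OrdConnected)
    (hqi : ∀ t x, IntegrableOn (q t x) S)
    (hL0 : ∀ y₁ ∈ S, ∀ y₂ ∈ S, 0 ≤ L y₁ y₂) (hKL : 0 < KL)
    (hLLip₁ : ∀ y₁ ∈ S, ∀ y₁' ∈ S, ∀ y₂ ∈ S, |L y₁ y₂ - L y₁' y₂| ≤ KL * |y₁ - y₁'|)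
    (hLi : ∀ y₂ ∈ S, IntegrableOn (fun y₁ => L y₁ y₂) S) {s : ℝ} (hs : s ∈ S)
    (x : E) (t : Fin 2) : IntegrableOn (fun y => L y s * q t x y) S := by
  obtain ⟨c, hc⟩ := exists_le_of_lipschitz_of_integrableOn hS hKL.le
    (fun y hy ↦ hL0 y hy s hs) (fun y hy y' hy' ↦ hLLip₁ y hy y' hy' s hs) (hLi s hs)
  refine (hqi t x).bdd_mul (c := c) (hLi s hs).aestronglyMeasurable
    ((ae_restrict_iff' hS.measurableSet).2 (ae_of_all _ fun y hy ↦ ?_))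
  rw [Real.norm_eq_abs, abs_of_nonneg (hL0 y hy s hs)]
  exact hc y hy

variable [NormedAddCommGroup E]

/-- Change the prediction first and the density second: the first change is integrated against a
density of mass 1, the second against a loss of mass at most `M`. -/
theorem abs_unitLoss_sub_le (hS : S.OrdConnected)
    (hqi : ∀ t x, IntegrableOn (q t x) S) (hq0 : ∀ t x, ∀ y ∈ S, 0 ≤ q t x y)
    (hq1 : ∀ t x, ∫ y in S, q t x y = 1) (hκ : 0 < κ)
    (hqLip : ∀ t, ∀ y ∈ S, ∀ x x', |q t x y - q t x' y| ≤ κ * ‖x - x'‖)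
    (hL0 : ∀ y₁ ∈ S, ∀ y₂ ∈ S, 0 ≤ L y₁ y₂) (hKL : 0 < KL)
    (hLLip₁ : ∀ y₁ ∈ S, ∀ y₁' ∈ S, ∀ y₂ ∈ S, |L y₁ y₂ - L y₁' y₂| ≤ KL * |y₁ - y₁'|)
    (hLLip₂ : ∀ y₁ ∈ S, ∀ y₂ ∈ S, ∀ y₂' ∈ S, |L y₁ y₂ - L y₁ y₂'| ≤ KL * |y₂ - y₂'|)
    (hM : ∀ y₂ ∈ S, IntegrableOn (fun y₁ => L y₁ y₂) S ∧ ∫ y₁ in S, L y₁ y₂ ≤ M)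
    (hM0 : 0 ≤ M) (hhS : ∀ r t, h r t ∈ S)
    (hhLip : ∀ t r r', |h r t - h r' t| ≤ b * κ * ‖r - r'‖)
    {c : ℝ} (hc : ∀ x x', ‖x - x'‖ ≤ c * ‖Φ x - Φ x'‖) (t : Fin 2) (x x' : E) :
    |unitLoss S L q h Φ x t - unitLoss S L q h Φ x' t| ≤
      (M * c + b * KL) * κ * ‖Φ x - Φ x'‖ := by
  have hint := fun {s} (hs : s ∈ S) (x : E) ↦
    integrableOn_loss_mul_density hS hqi hL0 hKL hLLip₁ (fun y hy ↦ (hM y hy).1) hs x t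
  set s := h (Φ x) t with hs_def
  set s' := h (Φ x') t with hs'_def
  have hs : s ∈ S := hhS _ _
  have hs' : s' ∈ S := hhS _ _
  have h1 : |unitLoss S L q h Φ x t - unitLoss S L q h Φ x' t| ≤
      ∫ y in S, (KL * |s - s'| * q t x y + L y s' * (κ * ‖x - x'‖)) := by
    rw [unitLoss, unitLoss, ← hs_def, ← hs'_def, ← integral_sub (hint hs x) (hint hs' x'),
      ← Real.norm_eq_abs]
    refine norm_integral_le_of_norm_le (((hqi t x).const_mul _).add ((hM s' hs').1.mul_const _))
      ((ae_restrict_iff' hS.measurableSet).2 (ae_of_all _ fun y hy ↦ ?_))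
    have e : L y s * q t x y - L y s' * q t x' y =
      (L y s - L y s') * q t x y + L y s' * (q t x y - q t x' y) := by ring
    rw [Real.norm_eq_abs, e]
    refine (abs_add_le _ _).trans (add_le_add ?_ ?_)
    · rw [abs_mul, abs_of_nonneg (hq0 t x y hy)]
      exact mul_le_mul_of_nonneg_right (hLLip₂ y hy s hs s' hs') (hq0 t x y hy)
    · rw [abs_mul, abs_of_nonneg (hL0 y hy s' hs')]
      exact mul_le_mul_of_nonneg_left (hqLip t y hy x x') (hL0 y hy s' hs')
  rw [integral_add ((hqi t x).const_mul _) ((hM s' hs').1.mul_const _), integral_const_mul,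
    integral_mul_const, hq1, mul_one] at h1
  have h2 : KL * |s - s'| ≤ KL * (b * κ * ‖Φ x - Φ x'‖) :=
    mul_le_mul_of_nonneg_left (hhLip t _ _) hKL.le
  have h3 : (∫ y in S, L y s') * (κ * ‖x - x'‖) ≤ M * (κ * (c * ‖Φ x - Φ x'‖)) :=
    mul_le_mul (hM s' hs').2 (mul_le_mul_of_nonneg_left (hc x x') hκ.le) (by positivity) hM0
  linarith

/-- A function that is Lipschitz as a function of `Φ` factors through `Φ` as a Lipschitz
function. -/
theorem exists_lipschitzWith_comp_eq {l : E → ℝ} {B : NNReal}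
    (hl : ∀ x x', |l x - l x'| ≤ B * ‖Φ x - Φ x'‖) :
    ∃ f : R → ℝ, LipschitzWith B f ∧ ∀ x, l x = f (Φ x) := by
  -- The estimate `hl` itself makes `l` constant on fibres of `Φ`, so injectivity is not needed.
  have hf : ∀ x, l (Function.invFun Φ (Φ x)) = l x := fun x ↦ by
    have := hl (Function.invFun Φ (Φ x)) x
    rw [Function.invFun_eq (f := Φ) ⟨x, rfl⟩, sub_self, norm_zero, mul_zero] at this
    exact sub_eq_zero.1 (abs_nonpos_iff.1 this)
  have hlip : LipschitzOnWith B (fun r ↦ l (Function.invFun Φ r)) (Set.range Φ) := by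
    refine LipschitzOnWith.of_dist_le_mul ?_
    rintro _ ⟨x, rfl⟩ _ ⟨x', rfl⟩
    rw [hf, hf, Real.dist_eq, dist_eq_norm]
    exact hl x x'
  obtain ⟨f, hfL, hfe⟩ := hlip.extend_real
  exact ⟨f, hfL, fun x ↦ (hf x).symm.trans (hfe ⟨x, rfl⟩)⟩

end UnitLoss

/-! ### Decomposition over treatment arms. -/

section Treatment

variable {Ω : Type*} [MeasurableSpace Ω] {P : Measure Ω} [IsProbabilityMeasure P]
  {A : Ω → Fin 2}

theorem integrable_of_forall_integrable_cond (hpos : ∀ a, P (A ⁻¹' {a}) ≠ 0)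
    {F : Type*} [NormedAddCommGroup F] {f : Ω → F}
    (hf : ∀ a, Integrable f (ProbabilityTheory.cond P (A ⁻¹' {a}))) : Integrable f P := by
  have h : IntegrableOn f (⋃ a, A ⁻¹' {a}) P := by
    refine integrableOn_finite_iUnion.2 fun a ↦ ?_
    have := hf a
    rw [ProbabilityTheory.cond] at this
    exact (integrable_smul_measure (ENNReal.inv_ne_zero.2 (measure_ne_top _ _))
      (ENNReal.inv_ne_top.2 (hpos a))).1 this
  rwa [← Set.preimage_iUnion, Set.iUnion_of_singleton, Set.preimage_univ,
    integrableOn_univ] at h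

theorem integral_eq_sum_integral_cond (hA : Measurable A) (hpos : ∀ a, P (A ⁻¹' {a}) ≠ 0)
    {g : Ω → Fin 2 → ℝ} (hg : Integrable (fun ω ↦ g ω (A ω)) P) :
    ∫ ω, g ω (A ω) ∂P =
      ∑ a, P.real (A ⁻¹' {a}) * ∫ ω, g ω a ∂(ProbabilityTheory.cond P (A ⁻¹' {a})) := by
  have hms : ∀ a, MeasurableSet (A ⁻¹' {a}) := fun a ↦ hA (measurableSet_singleton a)
  rw [← setIntegral_univ, ← Set.preimage_univ (f := A), ← Set.iUnion_of_singleton,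
    Set.preimage_iUnion, integral_iUnion_fintype hms ?_ fun a ↦ hg.integrableOn]
  · refine Finset.sum_congr rfl fun a _ ↦ ?_
    have hne : P.real (A ⁻¹' {a}) ≠ 0 := by
      simpa [Measure.real, ENNReal.toReal_eq_zero_iff] using hpos a
    rw [ProbabilityTheory.cond, integral_smul_measure, ENNReal.toReal_inv, smul_eq_mul,
      ← Measure.real, mul_inv_cancel_left₀ hne]
    exact setIntegral_congr_fun (hms a) fun ω hω ↦ by rw [show A ω = a from hω]
  · exact fun a a' hne ↦ (Set.disjoint_singleton.2 hne).preimage A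

end Treatment

/-! ### Mixtures with equal weights. -/

section Mixture

variable {E : Type*} [MeasurableSpace E]
  {κ : Type*} [Fintype κ] {w : κ → ℝ} {Q Q' : κ → Measure E} {μ μ' : Measure E}

theorem integrable_sum_smul_measure {F : Type*} [NormedAddCommGroup F] {f : E → F}
    (hμ : μ = ∑ k, ENNReal.ofReal (w k) • Q k) (hf : ∀ k, Integrable f (Q k)) :
    Integrable f μ := by
  rw [hμ]
  exact integrable_finsetSum_measure.2 fun k _ ↦ (hf k).smul_measure ENNReal.ofReal_ne_top

theorem integral_sum_smul_measure (hw : ∀ k, 0 ≤ w k)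
    (hμ : μ = ∑ k, ENNReal.ofReal (w k) • Q k) {f : E → ℝ} (hf : ∀ k, Integrable f (Q k)) :
    ∫ x, f x ∂μ = ∑ k, w k * ∫ x, f x ∂(Q k) := by
  rw [hμ, integral_finsetSum_measure fun k _ ↦ (hf k).smul_measure ENNReal.ofReal_ne_top]
  simp [integral_smul_measure, hw]

variable [NormedAddCommGroup E] [BorelSpace E]
  [∀ k, IsProbabilityMeasure (Q k)] [∀ k, IsProbabilityMeasure (Q' k)]

theorem abs_integral_sub_integral_le_mul_sum_W1 (hw : ∀ k, 0 ≤ w k)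
    (hμ : μ = ∑ k, ENNReal.ofReal (w k) • Q k) (hμ' : μ' = ∑ k, ENNReal.ofReal (w k) • Q' k)
    (hQ : ∀ k, Integrable (fun x ↦ x) (Q k)) (hQ' : ∀ k, Integrable (fun x ↦ x) (Q' k))
    {B : NNReal} {f : E → ℝ} (hf : LipschitzWith B f) :
    |∫ x, f x ∂μ - ∫ x, f x ∂μ'| ≤ B * ∑ k, w k * W1 (Q k) (Q' k) := by
  rw [integral_sum_smul_measure hw hμ fun k ↦ hf.integrable_of_integrable_id (hQ k),
    integral_sum_smul_measure hw hμ' fun k ↦ hf.integrable_of_integrable_id (hQ' k),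
    ← Finset.sum_sub_distrib, Finset.mul_sum]
  refine (Finset.abs_sum_le_sum_abs _ _).trans (Finset.sum_le_sum fun k _ ↦ ?_)
  rw [← mul_sub, abs_mul, abs_of_nonneg (hw k), mul_left_comm]
  exact mul_le_mul_of_nonneg_left
    (abs_integral_sub_integral_le_mul_W1 (hQ k) (hQ' k) hf) (hw k)

/-- If the components of two mixtures with equal weights are concentrated up to `σ` and each
component of the first is at least as close to its partner as to the other components of the
second, then matching partners is optimal for the Wasserstein distance up to `4 * σ`. -/
theorem sum_mul_W1_le_W1_add [IsProbabilityMeasure μ] [IsProbabilityMeasure μ']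
    (hw : w ∈ stdSimplex ℝ κ)
    (hμ : μ = ∑ k, ENNReal.ofReal (w k) • Q k) (hμ' : μ' = ∑ k, ENNReal.ofReal (w k) • Q' k)
    (hQ : ∀ k, Integrable (fun x ↦ x) (Q k)) (hQ' : ∀ k, Integrable (fun x ↦ x) (Q' k))
    (hdist : ∀ k k', k ≠ k' → W1 (Q k) (Q' k) ≤ W1 (Q k) (Q' k'))
    {m m' : κ → E} {σ : ℝ} (hm : ∀ k, ∫ x, ‖x - m k‖ ∂(Q k) ≤ σ)
    (hm' : ∀ k, ∫ x, ‖x - m' k‖ ∂(Q' k) ≤ σ) :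
    ∑ k, w k * W1 (Q k) (Q' k) ≤ W1 μ μ' + 4 * σ := by
  -- The test function. Of the total error `4 * σ`, `2 * σ` comes from replacing the two integrals
  -- by values at the means, and `2 * σ` from comparing means with `W1` in `h3`.
  have hf := Metric.lipschitz_infDist_pt (Set.range m')
  have hk : ∀ k, W1 (Q k) (Q' k) - 4 * σ ≤ ∫ x, Metric.infDist x (Set.range m') ∂(Q k) -
      ∫ x, Metric.infDist x (Set.range m') ∂(Q' k) := fun k ↦ by
    have h1 := (abs_le.1 ((abs_integral_sub_le_of_lipschitzWith hf (hQ k) (m k)).trans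
      (hm k))).1
    have h2 := (abs_le.1 ((abs_integral_sub_le_of_lipschitzWith hf (hQ' k) (m' k)).trans
      (hm' k))).2
    rw [Metric.infDist_zero_of_mem (Set.mem_range_self k)] at h2
    have h3 : W1 (Q k) (Q' k) - 2 * σ ≤ Metric.infDist (m k) (Set.range m') := by
      refine (Metric.le_infDist ⟨_, Set.mem_range_self k⟩).2 ?_
      rintro _ ⟨k', rfl⟩
      have h4 : W1 (Q k) (Q' k) ≤ W1 (Q k) (Q' k') := by
        rcases eq_or_ne k k' with rfl | hne
        exacts [le_rfl, hdist k k' hne]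
      have h5 := W1_le_add (hQ k) (hQ' k') (m k) (m' k')
      rw [dist_eq_norm]
      linarith [hm k, hm' k']
    linarith
  have h := integral_sub_integral_le_W1 (integrable_sum_smul_measure hμ hQ)
    (integrable_sum_smul_measure hμ' hQ') hf
  rw [integral_sum_smul_measure hw.1 hμ fun k ↦ hf.integrable_of_integrable_id (hQ k),
    integral_sum_smul_measure hw.1 hμ' fun k ↦ hf.integrable_of_integrable_id (hQ' k),
    ← Finset.sum_sub_distrib] at h
  have h6 := Finset.sum_le_sum fun k (_ : k ∈ Finset.univ) ↦
    mul_le_mul_of_nonneg_left (hk k) (hw.1 k)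
  simp only [mul_sub, Finset.sum_sub_distrib, ← Finset.sum_mul, hw.2, one_mul] at h6 h
  linarith

end Mixture

/-! ### Factual and counterfactual losses as integrals over representation laws. -/

section Losses

variable {Ω E R : Type*} [MeasurableSpace Ω] [MeasurableSpace E] {P : Measure Ω}
  [NormedAddCommGroup R] [MeasurableSpace R] [BorelSpace R]
  {X : Ω → E} {A : Ω → Fin 2} {Φ : E → R} {l : E → Fin 2 → ℝ} {f : Fin 2 → R → ℝ} {B : NNReal}

theorem armFactualLoss_eq_integral_repLaw (hX : Measurable X) (hΦ : Measurable Φ)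
    (hf : ∀ t, LipschitzWith B (f t)) (hl : ∀ x t, l x t = f t (Φ x)) (t : Fin 2) :
    armFactualLoss P X A l t = ∫ r, f t r ∂(repLaw P X A Φ t) := by
  have hfm : ∀ t, Measurable (f t) := fun t ↦ (hf t).continuous.measurable
  simp only [armFactualLoss, covariateLaw, repLaw, hl]
  exact (integral_map hX.aemeasurable ((hfm t).comp hΦ).aestronglyMeasurable).trans
    (integral_map (hΦ.comp hX).aemeasurable (hfm t).aestronglyMeasurable).symm

variable [IsProbabilityMeasure P]

theorem integrable_comp_repr (hX : Measurable X) (hΦ : Measurable Φ)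
    (hpos : ∀ a, P (A ⁻¹' {a}) ≠ 0) (hrep : ∀ a, Integrable (fun r ↦ r) (repLaw P X A Φ a))
    (hf : ∀ t, LipschitzWith B (f t)) {T : Ω → Fin 2} (hT : Measurable T) :
    Integrable (fun ω ↦ f (T ω) (Φ (X ω))) P := by
  have hfm : ∀ t, Measurable (f t) := fun t ↦ (hf t).continuous.measurable
  have h : ∀ t, Integrable (fun ω ↦ f t (Φ (X ω))) P := fun t ↦ by
    refine integrable_of_forall_integrable_cond hpos fun a ↦ ?_
    have := cond_isProbabilityMeasure (hpos a)
    have : IsProbabilityMeasure (repLaw P X A Φ a) :=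
      Measure.isProbabilityMeasure_map (hΦ.comp hX).aemeasurable
    exact ((hf t).integrable_of_integrable_id (hrep a)).comp_measurable (hΦ.comp hX)
  refine (integrable_finsetSum Finset.univ fun t _ ↦ (h t).norm).mono' ?_
    (ae_of_all _ fun ω ↦ Finset.single_le_sum (f := fun t ↦ ‖f t (Φ (X ω))‖)
      (fun t _ ↦ norm_nonneg _) (Finset.mem_univ (T ω)))
  have hm : Measurable fun z : R × Fin 2 ↦ f z.2 z.1 := measurable_from_prod_countable_left hfm
  exact (hm.comp ((hΦ.comp hX).prodMk hT)).aestronglyMeasurable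

theorem integrable_map_of_comp_repr (hX : Measurable X) (hΦ : Measurable Φ)
    (hpos : ∀ a, P (A ⁻¹' {a}) ≠ 0) (hrep : ∀ a, Integrable (fun r ↦ r) (repLaw P X A Φ a))
    (hf : ∀ t, LipschitzWith B (f t)) (hl : ∀ x t, l x t = f t (Φ x))
    {T : Ω → Fin 2} (hT : Measurable T) :
    Integrable (fun z ↦ l z.1 z.2) (P.map fun ω ↦ (X ω, T ω)) := by
  have hm : Measurable fun z : E × Fin 2 ↦ f z.2 (Φ z.1) :=
    measurable_from_prod_countable_left fun t ↦ (hf t).continuous.measurable.comp hΦ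
  simp only [hl]
  rw [integrable_map_measure hm.aestronglyMeasurable (hX.prodMk hT).aemeasurable]
  exact integrable_comp_repr hX hΦ hpos hrep hf hT

/-- Units of arm `a` are charged the loss of treatment `1 - a`, so `f 1` is integrated over arm 0
with weight `1 - u`, and `f 0` over arm 1 with weight `u`. -/
theorem counterfactualLoss_eq_integral_repLaw (hX : Measurable X) (hA : Measurable A)
    (hΦ : Measurable Φ)
    (hpos : ∀ a, P (A ⁻¹' {a}) ≠ 0) (hrep : ∀ a, Integrable (fun r ↦ r) (repLaw P X A Φ a))
    (hf : ∀ t, LipschitzWith B (f t)) (hl : ∀ x t, l x t = f t (Φ x)) :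
    counterfactualLoss P X A l =
      (1 - P.real (A ⁻¹' {1})) * ∫ r, f 1 r ∂(repLaw P X A Φ 0) +
        P.real (A ⁻¹' {1}) * ∫ r, f 0 r ∂(repLaw P X A Φ 1) := by
  have hfm : ∀ t, Measurable (f t) := fun t ↦ (hf t).continuous.measurable
  have hA' : Measurable fun ω ↦ 1 - A ω := (measurable_of_countable fun t : Fin 2 ↦ 1 - t).comp hA
  have hm : Measurable fun z : E × Fin 2 ↦ f z.2 (Φ z.1) :=
    measurable_from_prod_countable_left fun t ↦ (hfm t).comp hΦ
  have hrl : ∀ a t, ∫ r, f t r ∂(repLaw P X A Φ a) =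
      ∫ ω, f t (Φ (X ω)) ∂(ProbabilityTheory.cond P (A ⁻¹' {a})) := fun a t ↦
    integral_map (hΦ.comp hX).aemeasurable (hfm t).aestronglyMeasurable
  have h0 : P.real (A ⁻¹' {0}) = 1 - P.real (A ⁻¹' {1}) := by
    rw [← probReal_compl_eq_one_sub (hA (measurableSet_singleton 1)), ← Set.preimage_compl]
    congr 2
    ext a
    fin_cases a <;> simp
  simp only [counterfactualLoss, counterfactualLaw, hl]
  rw [integral_map (hX.prodMk hA').aemeasurable hm.aestronglyMeasurable,
    integral_eq_sum_integral_cond (g := fun ω a ↦ f (1 - a) (Φ (X ω))) hA hpos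
      (integrable_comp_repr hX hΦ hpos hrep hf hA'), Fin.sum_univ_two, h0, hrl, hrl]
  simp

/-- If expectations of Lipschitz functions of the representation differ by at most `D` between the
two arms, then so do the counterfactual loss and `ε_F^⋆`. -/
theorem counterfactualLoss_le_factualLossStar_add (hX : Measurable X) (hA : Measurable A)
    (hΦ : Measurable Φ)
    (hpos : ∀ a, P (A ⁻¹' {a}) ≠ 0) (hrep : ∀ a, Integrable (fun r ↦ r) (repLaw P X A Φ a))
    (hf : ∀ t, LipschitzWith B (f t)) (hl : ∀ x t, l x t = f t (Φ x)) {D : ℝ}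
    (hD : ∀ t, |∫ r, f t r ∂(repLaw P X A Φ 0) - ∫ r, f t r ∂(repLaw P X A Φ 1)| ≤ D) :
    counterfactualLoss P X A l ≤ factualLossStar P X A l + D := by
  rw [counterfactualLoss_eq_integral_repLaw hX hA hΦ hpos hrep hf hl, factualLossStar,
    armFactualLoss_eq_integral_repLaw hX hΦ hf hl, armFactualLoss_eq_integral_repLaw hX hΦ hf hl]
  have hu0 : 0 ≤ P.real (A ⁻¹' {1}) := measureReal_nonneg
  have hu1 : 0 ≤ 1 - P.real (A ⁻¹' {1}) := sub_nonneg.2 measureReal_le_one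
  have h1 := mul_le_mul_of_nonneg_left (abs_le.1 (hD 1)).2 hu1
  have h2 := mul_le_mul_of_nonneg_left (abs_le.1 (hD 0)).1 hu0
  linarith

end Losses

/-! ### The generalization bounds. -/

theorem theorem2
    -- units: covariates `X`, treatment `A`, potential outcomes `Y 0`, `Y 1`
    {Ω : Type*} [MeasurableSpace Ω] (P : Measure Ω) [IsProbabilityMeasure P] {d : ℕ}
    (X : Ω → EuclideanSpace ℝ (Fin d)) (A : Ω → Fin 2) (Y : Fin 2 → Ω → ℝ)
    (hX : Measurable X) (hA : Measurable A) (hY : ∀ t, Measurable (Y t))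
    (hu0 : 0 < P.real (A ⁻¹' {1})) (hu1 : P.real (A ⁻¹' {1}) < 1)
    -- the outcome space, an interval, and the conditional densities `p(Y_t | x)`
    (S : Set ℝ) (hS : S.OrdConnected)
    (q : Fin 2 → EuclideanSpace ℝ (Fin d) → ℝ → ℝ)
    (hq : ∀ t, IsCondDensity P X (Y t) S (q t))
    (κ : ℝ) (hκ : 0 < κ)
    (hqLip : ∀ t, ∀ y ∈ S, ∀ x x', |q t x y - q t x' y| ≤ κ * ‖x - x'‖)
    -- the loss function
    (L : ℝ → ℝ → ℝ) (hL0 : ∀ y₁ ∈ S, ∀ y₂ ∈ S, 0 ≤ L y₁ y₂)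
    (KL : ℝ) (hKL : 0 < KL)
    (hLLip₁ : ∀ y₁ ∈ S, ∀ y₁' ∈ S, ∀ y₂ ∈ S, |L y₁ y₂ - L y₁' y₂| ≤ KL * |y₁ - y₁'|)
    (hLLip₂ : ∀ y₁ ∈ S, ∀ y₂ ∈ S, ∀ y₂' ∈ S, |L y₁ y₂ - L y₁ y₂'| ≤ KL * |y₂ - y₂'|)
    (M : ℝ) (hM : ∀ y₂ ∈ S, IntegrableOn (fun y₁ => L y₁ y₂) S ∧ ∫ y₁ in S, L y₁ y₂ ≤ M)
    -- the representation
    (Φ : EuclideanSpace ℝ (Fin d) → EuclideanSpace ℝ (Fin d))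
    (hΦ : ContDiff ℝ 1 Φ) (hΦinj : Function.Injective Φ) (hΦJ : JacobianNormalized Φ)
    (hρ : 0 < ⨅ x, sigmaMin Φ x)
    -- the hypothesis
    (h : EuclideanSpace ℝ (Fin d) → Fin 2 → ℝ) (hhS : ∀ r t, h r t ∈ S)
    (b : ℝ) (hb : 0 ≤ b) (hhLip : ∀ t r r', |h r t - h r' t| ≤ b * κ * ‖r - r'‖)
    -- the sub-treatment groups
    {K : ℕ} (w : Fin 2 → Fin K → ℝ) (hw : ∀ a, w a ∈ stdSimplex ℝ (Fin K))
    (Q : Fin 2 → Fin K → Measure (EuclideanSpace ℝ (Fin d)))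
    (hmix : ∀ a, repLaw P X A Φ a = ∑ k, ENNReal.ofReal (w a k) • Q a k)
    -- A1
    (m : Fin 2 → Fin K → EuclideanSpace ℝ (Fin d))
    (C : Fin 2 → Fin K → Matrix (Fin d) (Fin d) ℝ) (hC : ∀ a k, (C a k).PosSemidef)
    (hQ : ∀ a k, Q a k = multivariateGaussian (m a k) (C a k))
    (hdist : ∀ k k', k ≠ k' → W1 (Q 0 k) (Q 1 k) ≤ W1 (Q 0 k) (Q 1 k'))
    -- A2
    (hweights : ∀ k, w 1 k = w 0 k)
    (ε : ℝ) (hε : 0 < ε) (htr : ∀ a k, (C a k).trace ≤ ε) :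
    -- the losses are well defined
    ((∀ x t, IntegrableOn (fun y => L y (h (Φ x) t) * q t x y) S) ∧
      Integrable (fun z => unitLoss S L q h Φ z.1 z.2) (factualLaw P X A) ∧
      Integrable (fun z => unitLoss S L q h Φ z.1 z.2) (counterfactualLaw P X A)) ∧
    -- (i)
    counterfactualLoss P X A (unitLoss S L q h Φ) ≤
      factualLossStar P X A (unitLoss S L q h Φ) +
        2 * ((M * rho Φ + b * KL) * κ) * ∑ k, w 1 k * W1 (Q 0 k) (Q 1 k) ∧
    (1 ≤ KL →
      counterfactualLoss P X A (unitLoss S L q h Φ) ≤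
        factualLossStar P X A (unitLoss S L q h Φ) +
          2 * ((M * rho Φ + b) * κ * KL) * ∑ k, w 1 k * W1 (Q 0 k) (Q 1 k)) ∧
    -- (ii)
    ∑ k, w 1 k * W1 (Q 0 k) (Q 1 k) ≤
      W1 (repLaw P X A Φ 0) (repLaw P X A Φ 1) + 4 * √ε := by
  have hpos : ∀ a, P (A ⁻¹' {a}) ≠ 0 := by
    have h1 : P (A ⁻¹' {1}) ≠ 0 := fun h0 ↦ by simp [Measure.real, h0] at hu0
    have h0 : P (A ⁻¹' {0}) ≠ 0 := fun h0 ↦ by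
      have he : (A ⁻¹' {1})ᶜ = A ⁻¹' {0} := by
        rw [← Set.preimage_compl]
        congr 1
        ext a
        fin_cases a <;> simp
      have := probReal_compl_eq_one_sub (μ := P) (hA (measurableSet_singleton 1))
      rw [he, Measure.real, h0, ENNReal.toReal_zero] at this
      linarith
    exact Fin.forall_fin_two.2 ⟨h0, h1⟩
  have hΦm : Measurable Φ := hΦ.continuous.measurable
  have hrepP : ∀ a, IsProbabilityMeasure (repLaw P X A Φ a) := fun a ↦
    have := cond_isProbabilityMeasure (hpos a)
    Measure.isProbabilityMeasure_map (hΦm.comp hX).aemeasurable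
  have hG : ∀ a k, IsGaussian (Q a k) := fun a k ↦ by rw [hQ]; infer_instance
  have hQi : ∀ a k, Integrable (fun x ↦ x) (Q a k) := fun a k ↦ IsGaussian.integrable_id
  have hσ : ∀ a k, ∫ x, ‖x - m a k‖ ∂(Q a k) ≤ √ε := fun a k ↦ by
    rw [hQ]
    exact (integral_norm_sub_mean_le_sqrt_trace (m a k) (hC a k)).trans
      (Real.sqrt_le_sqrt (htr a k))
  have hw01 : w 0 = w 1 := funext fun k ↦ (hweights k).symm
  have hmix0 := hmix 0
  have hmix1 := hmix 1
  rw [hw01] at hmix0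
  have hrep : ∀ a, Integrable (fun r ↦ r) (repLaw P X A Φ a) := fun a ↦
    integrable_sum_smul_measure (hmix a) (hQi a)
  have hqi := fun t x ↦ (hq t).integrableOn x
  have hM0 : 0 ≤ M := (setIntegral_nonneg hS.measurableSet fun y hy ↦
    hL0 y hy _ (hhS 0 0)).trans (hM _ (hhS 0 0)).2
  have hρ0 : 0 ≤ rho Φ := by
    rw [rho_eq_inv hΦJ]
    exact inv_nonneg.2 hρ.le
  have hB0 : 0 ≤ (M * rho Φ + b * KL) * κ := by positivity
  obtain ⟨B, hB⟩ : ∃ B : NNReal, (B : ℝ) = (M * rho Φ + b * KL) * κ := ⟨⟨_, hB0⟩, rfl⟩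
  have hfac : ∀ t, ∃ f : EuclideanSpace ℝ (Fin d) → ℝ,
      LipschitzWith B f ∧
        ∀ x, unitLoss S L q h Φ x t = f (Φ x) := fun t ↦
    exists_lipschitzWith_comp_eq (hB.symm ▸ abs_unitLoss_sub_le hS hqi (fun t ↦ (hq t).nonneg)
      (fun t ↦ (hq t).integral_eq_one) hκ hqLip hL0 hKL hLLip₁ hLLip₂ hM hM0 hhS hhLip
      (by rw [rho_eq_inv hΦJ]; exact norm_sub_le_of_iInf_sigmaMin_pos hΦ hΦinj hρ) t)
  choose f hf hl using hfac
  have hl' := fun x t ↦ hl t x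
  have hsum : 0 ≤ ∑ k, w 1 k * W1 (Q 0 k) (Q 1 k) :=
    Finset.sum_nonneg fun k _ ↦ mul_nonneg ((hw 1).1 k) (W1_nonneg (hQi 0 k) (hQi 1 k))
  have hmain := counterfactualLoss_le_factualLossStar_add hX hA hΦm hpos hrep hf hl' fun t ↦
    abs_integral_sub_integral_le_mul_sum_W1 (hw 1).1 hmix0 hmix1 (hQi 0) (hQi 1) (hf t)
  have hmain : counterfactualLoss P X A (unitLoss S L q h Φ) ≤
      factualLossStar P X A (unitLoss S L q h Φ) +
        2 * ((M * rho Φ + b * KL) * κ) * ∑ k, w 1 k * W1 (Q 0 k) (Q 1 k) := by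
    -- The bound already holds with factor 1; nonnegativity allows doubling it.
    have := mul_nonneg hB0 hsum
    rw [hB] at hmain
    linarith
  refine ⟨⟨fun x t ↦ integrableOn_loss_mul_density hS hqi hL0 hKL hLLip₁
    (fun y hy ↦ (hM y hy).1) (hhS _ _) x t, integrable_map_of_comp_repr hX hΦm hpos hrep hf hl' hA,
    integrable_map_of_comp_repr hX hΦm hpos hrep hf hl'
      ((measurable_of_countable fun t : Fin 2 ↦ 1 - t).comp hA)⟩, hmain, fun hKL1 ↦ ?_,
    sum_mul_W1_le_W1_add (hw 1) hmix0 hmix1 (hQi 0) (hQi 1) hdist (hσ 0) (hσ 1)⟩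
  refine hmain.trans (add_le_add_right (mul_le_mul_of_nonneg_right
    (mul_le_mul_of_nonneg_left ?_ zero_le_two) hsum) _)
  -- The two constants differ by `M * rho Φ * κ * (KL - 1)`.
  have := mul_nonneg (mul_nonneg (mul_nonneg hM0 hρ0) hκ.le) (sub_nonneg.2 hKL1)
  linarith
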